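/- For a finite group $G$, an integer $r\ge 1$ and a word $w$ in the free group $F_r$ on $r$ generators, let $N_{w,G}\colon G\to\mathbb{C}$ be the function $$N_{w,G}(g)=\bigl|\{(g_1,\dots,g_r)\in G^r : w(g_1,\dots,g_r)=g\}\bigr|,$$ where $w(g_1,\dots,g_r)$ is obtained by substituting $g_i$ for the $i$-th generator. Call $G$ *semi-rational* if for every $r\ge 1$ and every $w\in F_r$ the function $N_{w,G}$ is a generalized character of $G$, that is, a difference of two characters of finite-dimensional complex representations of $G$ (the zero representation being allowed). Say that $G$ satisfies the *Amit–Vishne condition* if for all $g,h\in G$ with $\langle g\rangle=\langle h\rangle$ there is an automorphism $\alpha\in\mathrm{Aut}(G)$ with $\alpha(g)=h$. **Proposition.** Let $G$ be a finite simple group. Then $G$ is semi-rational if and only if $G$ satisfies the Amit–Vishne condition. -/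

import Mathlib

/-- The function `N_{w,G} : G → ℂ` of a word `w` in the free group on `r` generators: `N_{w,G}(g)` is
the number of `r`-tuples `t` of elements of `G` with `w(t) = g`, where `w(t)` is the result of
substituting `t i` for the `i`-th generator. -/
noncomputable def wordCount (G : Type*) [Group G] {r : ℕ} (w : FreeGroup (Fin r)) (g : G) : ℂ :=
  (Nat.card {t : Fin r → G // FreeGroup.lift t w = g} : ℂ)

/-- `f` is the character of a finite-dimensional complex representation of `G`
(the zero-dimensional one is allowed, so that `0` counts as a character). -/
def IsComplexCharacter {G : Type*} [Group G] (f : G → ℂ) : Prop :=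
  ∃ (n : ℕ) (ρ : Representation ℂ G (Fin n → ℂ)), f = ρ.character

/-- A generalized (virtual) character is a difference of two characters. -/
def IsGeneralizedCharacter {G : Type*} [Group G] (f : G → ℂ) : Prop :=
  ∃ φ ψ : G → ℂ, IsComplexCharacter φ ∧ IsComplexCharacter ψ ∧ f = φ - ψ

/-- A finite group `G` is semi-rational if `N_{w,G}` is a generalized character for every `r ≥ 1` and
every word `w` in the free group on `r` generators. (The empty alphabet `r = 0` has to be excluded:
there `N_{1,G}` is the indicator function of `{1}`, which is not a generalized character unless `G`
is trivial.) -/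
def IsSemiRational (G : Type*) [Group G] : Prop :=
  ∀ (r : ℕ), 1 ≤ r → ∀ w : FreeGroup (Fin r), IsGeneralizedCharacter (wordCount G w)

/-- The Amit–Vishne condition: any two elements generating the same cyclic subgroup lie in the same
orbit of the automorphism group. -/
def AmitVishneCondition (G : Type*) [Group G] : Prop :=
  ∀ g h : G, Subgroup.zpowers g = Subgroup.zpowers h → ∃ α : MulAut G, α g = h

/-! Word counts are integer-valued and invariant under `Aut(G)`.

If they are generalized characters, Galois conjugation makes them constant on the generators of each
cyclic subgroup. For nonabelian `G`, let `φ` be an epimorphism from a free group. Homomorphisms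
outside the `Aut(G)`-orbit of `φ` are independent of `φ`, so some word `w` has `φ w = g` and is
killed by all of them (`exists_map_eq_and_forall_map_eq_one`). Away from `1`, its count is then
supported on the `Aut(G)`-orbit of `g`, so that orbit contains every generator of `⟨g⟩`. In the
abelian case power maps provide the automorphisms.

Conversely, a class function is a generalized character as soon as its inner products with
characters are integers. The Amit–Vishne condition makes those of a word count Galois-invariant,
hence rational, and it remains to see that they are algebraic integers. For at least two letters,
Solomon's theorem says that `|C(g)|` divides the count at `g`, so each conjugacy class contributes
an integer multiple of a character value. For one letter the inner product is the average of some `χ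
(g ^ n)`, the trace of a cyclic shift composed with a commuting projection on a tensor power. -/

/-! ### Automorphism invariance of word counts. -/

theorem FreeGroup.lift_comp_apply {ι G H : Type*} [Group G] [Group H] (f : G →* H) (t : ι → G)
    (w : FreeGroup ι) : FreeGroup.lift (fun i => f (t i)) w = f (FreeGroup.lift t w) := by
  have : FreeGroup.lift (fun i => f (t i)) = f.comp (FreeGroup.lift t) := by
    ext i; simp
  rw [this]; rfl

theorem wordCount_mulAut {G : Type*} [Group G] {r : ℕ} (w : FreeGroup (Fin r)) (α : MulAut G)
    (g : G) : wordCount G w (α g) = wordCount G w g := by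
  unfold wordCount
  congr 1
  refine (Nat.card_congr ((Equiv.piCongrRight (fun _ : Fin r => α.toEquiv)).subtypeEquiv
    fun t => ?_)).symm
  have := FreeGroup.lift_comp_apply α.toMonoidHom t w
  constructor
  · intro h
    exact this.trans (congrArg α h)
  · intro h
    exact α.injective (this.symm.trans h)

theorem wordCount_conj {G : Type*} [Group G] {r : ℕ} (w : FreeGroup (Fin r)) (g h : G) :
    wordCount G w (h * g * h⁻¹) = wordCount G w g :=
  wordCount_mulAut w (MulAut.conj h) g

/-! ### Words separating automorphism orbits in finite simple groups. -/

/-- A homomorphism to a finite group whose kernel lies in the kernel of an epimorphism `φ` to the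
same group differs from `φ` by an automorphism. -/
theorem MonoidHom.exists_mulAut_comp_eq_of_ker_le {F G : Type*} [Group F] [Group G] [Finite G]
    {φ ψ : F →* G} (hφ : Function.Surjective φ) (h : ψ.ker ≤ φ.ker) :
    ∃ α : MulAut G, ∀ x, ψ x = α (φ x) := by
  have hker : φ.ker ≤ ψ.ker := by
    -- `φ` factors through a surjection `β` from the range of `ψ` onto `G`. The range has at most
    -- `|G|` elements, so `β` is injective and the kernels coincide.
    let β := ψ.rangeRestrict.liftOfSurjective ψ.rangeRestrict_surjective ⟨φ, by simpa using h⟩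
    have hβ (x : F) : β (ψ.rangeRestrict x) = φ x :=
      MonoidHom.liftOfRightInverse_comp_apply _ _ _ _ _
    have hs : Function.Surjective β := fun y => by
      obtain ⟨x, rfl⟩ := hφ y
      exact ⟨_, hβ x⟩
    have hb : Function.Bijective β :=
      hs.bijective_of_nat_card_le (Nat.card_le_card_of_injective _ Subtype.val_injective)
    intro x hx
    have : β (ψ.rangeRestrict x) = β 1 := by
      rw [hβ, map_one]; exact hx
    exact congrArg Subtype.val (hb.1 this)
  let α := φ.liftOfSurjective hφ ⟨ψ, hker⟩
  have hα (x : F) : α (φ x) = ψ x := MonoidHom.liftOfRightInverse_comp_apply _ _ _ _ _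
  have hi : Function.Injective α := by
    rw [injective_iff_map_eq_one]
    intro a ha
    obtain ⟨x, rfl⟩ := hφ a
    rw [hα] at ha
    exact h ha
  exact ⟨MulEquiv.ofBijective α (Finite.injective_iff_bijective.1 hi), fun x => (hα x).symm⟩

/-- In a nonabelian finite simple group, an epimorphism `φ : F →* G` is independent of finitely many
homomorphisms that are not in its `Aut(G)`-orbit. -/
theorem exists_map_eq_and_forall_map_eq_one {F G : Type*} [Group F] [Group G] [Finite G]
    [IsSimpleGroup G] (hG : ¬ ∀ a b : G, a * b = b * a) {φ : F →* G}
    (hφ : Function.Surjective φ) (S : Finset (F →* G))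
    (hS : ∀ ψ ∈ S, ¬ ∃ α : MulAut G, ∀ x, ψ x = α (φ x)) (g : G) :
    ∃ w, φ w = g ∧ ∀ ψ ∈ S, ψ w = 1 := by
  classical
  induction S using Finset.induction_on generalizing g with
  | empty =>
    obtain ⟨w, rfl⟩ := hφ g
    exact ⟨w, rfl, by simp⟩
  | insert ψ S _ ih =>
    have ih := ih fun ψ hψ => hS ψ (Finset.mem_insert_of_mem hψ)
    have hψ : ¬ ψ.ker ≤ φ.ker := fun h =>
      hS ψ (Finset.mem_insert_self _ _) (MonoidHom.exists_mulAut_comp_eq_of_ker_le hφ h)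
    obtain ⟨l, hl, hl'⟩ := SetLike.not_le_iff_exists.1 hψ
    let N : Subgroup F := ⨅ χ ∈ insert ψ S, χ.ker
    have hN (x : F) : x ∈ N ↔ ∀ χ ∈ insert ψ S, χ x = 1 := by
      simp [N, Subgroup.mem_iInf, MonoidHom.mem_ker]
    have hNn : N.Normal := ⟨fun n hn y => by
      rw [hN] at hn ⊢
      intro χ hχ
      simp [hn χ hχ]⟩
    have hmap : (N.map φ).Normal := hNn.map φ hφ
    suffices N.map φ = ⊤ by
      have hg : g ∈ N.map φ := by rw [this]; trivial
      obtain ⟨w, hw, rfl⟩ := hg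
      exact ⟨w, rfl, (hN w).1 hw⟩
    refine hmap.eq_bot_or_eq_top.resolve_left fun hbot => ?_
    -- If `n` is killed by `S`, the commutator of `n` and `l` is killed by `S` through `n` and by
    -- `ψ` through `l`, so it lies in `N`. By induction `φ n` is arbitrary, so `φ l ≠ 1` would be
    -- central.
    have hcen : φ l ∈ Subgroup.center G := by
      rw [Subgroup.mem_center_iff]
      intro x
      obtain ⟨n, rfl, hn⟩ := ih x
      have : n * l * n⁻¹ * l⁻¹ ∈ N := by
        rw [hN]
        intro χ hχ
        rcases Finset.mem_insert.1 hχ with rfl | hχ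
        · simp [MonoidHom.mem_ker.1 hl]
        · simp [hn χ hχ]
      have := Subgroup.mem_map_of_mem φ this
      rw [hbot, Subgroup.mem_bot] at this
      simp only [map_mul, map_inv] at this
      rwa [mul_inv_eq_one, mul_inv_eq_iff_eq_mul] at this
    rcases (inferInstance : (Subgroup.center G).Normal).eq_bot_or_eq_top with h | h
    · rw [h, Subgroup.mem_bot] at hcen
      exact hl' hcen
    · refine hG fun a b => ?_
      have : b ∈ Subgroup.center G := by rw [h]; trivial
      exact Subgroup.mem_center_iff.1 this a

/-- An abelian simple group satisfies the Amit–Vishne condition. -/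
theorem amitVishneCondition_of_comm {G : Type*} [Group G] [Finite G] [IsSimpleGroup G]
    (hG : ∀ a b : G, a * b = b * a) : AmitVishneCondition G := by
  intro g h hgh
  by_cases hg : h = 1
  · subst hg
    rw [Subgroup.zpowers_one_eq_bot, Subgroup.zpowers_eq_bot] at hgh
    exact ⟨1, hgh⟩
  have hh : h ∈ Subgroup.zpowers g := hgh ▸ Subgroup.mem_zpowers h
  obtain ⟨k, rfl⟩ := hh
  let f : G →* G := ⟨⟨fun x => x ^ k, one_zpow k⟩, fun a b => (show Commute a b from hG a b).mul_zpow k⟩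
  have hker : f.ker = ⊥ := by
    refine (inferInstance : f.ker.Normal).eq_bot_or_eq_top.resolve_right fun h => hg ?_
    have : g ∈ f.ker := by rw [h]; trivial
    exact this
  exact ⟨MulEquiv.ofBijective f
    (Finite.injective_iff_bijective.1 ((MonoidHom.ker_eq_bot_iff f).1 hker)), rfl⟩

/-- If word counts do not separate generators of the same cyclic subgroup of a finite simple group,
then the group satisfies the Amit–Vishne condition. -/
theorem amitVishneCondition_of_wordCount_eq {G : Type*} [Group G] [Finite G] [IsSimpleGroup G]
    (H : ∀ r : ℕ, 1 ≤ r → ∀ (w : FreeGroup (Fin r)) (g h : G),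
      Subgroup.zpowers g = Subgroup.zpowers h → wordCount G w g = wordCount G w h) :
    AmitVishneCondition G := by
  by_cases hG : ∀ a b : G, a * b = b * a
  · exact amitVishneCondition_of_comm hG
  intro g h hgh
  -- The word chosen below may take the value `1` at any tuple outside the orbit, so `h = 1` is
  -- treated apart.
  by_cases hh : h = 1
  · subst hh
    rw [Subgroup.zpowers_one_eq_bot, Subgroup.zpowers_eq_bot] at hgh
    exact ⟨1, hgh⟩
  let t : Fin (Nat.card G) → G := (Finite.equivFin G).symm
  let φ : FreeGroup (Fin (Nat.card G)) →* G := FreeGroup.lift t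
  have hφ : Function.Surjective φ := fun x => ⟨FreeGroup.of (Finite.equivFin G x), by simp [φ, t]⟩
  have : Finite (FreeGroup (Fin (Nat.card G)) →* G) := Finite.of_equiv _ FreeGroup.lift
  let S := {ψ : FreeGroup (Fin (Nat.card G)) →* G | ¬ ∃ α : MulAut G, ∀ x, ψ x = α (φ x)}
  have hS : S.Finite := Set.toFinite S
  obtain ⟨w, hw, hw1⟩ := exists_map_eq_and_forall_map_eq_one hG hφ hS.toFinset
    (fun ψ hψ => hS.mem_toFinset.1 hψ) g
  have hN := H _ Nat.card_pos w g h hgh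
  unfold wordCount at hN
  have hne : Nonempty {t : Fin (Nat.card G) → G // FreeGroup.lift t w = g} := ⟨⟨t, hw⟩⟩
  have hpos : Nat.card {t : Fin (Nat.card G) → G // FreeGroup.lift t w = h} ≠ 0 := by
    rw [← Nat.cast_injective hN]
    exact Nat.card_pos.ne'
  obtain ⟨⟨s, hs⟩⟩ := (Nat.card_ne_zero.1 hpos).1
  by_contra hno
  have hsS : FreeGroup.lift s ∈ S := fun ⟨α, hα⟩ => hno ⟨α, by rw [← hs, hα, hw]⟩
  exact hh (hs ▸ hw1 _ (hS.mem_toFinset.2 hsS))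

/-! ### Solomon's theorem. -/

/-- Let `deg : F →* ℤ` be a homomorphism with `deg t = 1`. A homomorphism `φ` can be changed at `t`
by a factor that centralizes the image of the kernel of `deg`. -/
theorem MonoidHom.exists_twist {F G : Type*} [Group F] [Group G] (deg : F →* Multiplicative ℤ)
    {t : F} (ht : deg t = Multiplicative.ofAdd 1) (φ : F →* G) {z : G}
    (hz : ∀ k ∈ deg.ker, φ k * z = z * φ k) :
    ∃ ψ : F →* G, (∀ k ∈ deg.ker, ψ k = φ k) ∧ ψ t = φ t * z := by
  let Z : Subgroup G := Subgroup.centralizer (φ '' deg.ker)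
  have hZ (a : G) : a ∈ Z ↔ ∀ k ∈ deg.ker, φ k * a = a * φ k := by
    simp [Z, Subgroup.mem_centralizer_iff]
  have hzZ : z ∈ Z := (hZ z).2 hz
  have hconj (x : F) (a : G) (ha : a ∈ Z) : φ x * a * (φ x)⁻¹ ∈ Z := by
    rw [hZ] at ha ⊢
    intro k hk
    have := ha (x⁻¹ * k * x) (by simpa using (inferInstance : deg.ker.Normal).conj_mem k hk x⁻¹)
    simp only [map_mul, map_inv] at this
    calc φ k * (φ x * a * (φ x)⁻¹) = φ x * ((φ x)⁻¹ * φ k * φ x * a) * (φ x)⁻¹ := by group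
      _ = _ := by rw [this]; group
  -- The twist must send `t ^ n` to `(φ t * z) ^ n`; `c n` is the correction factor to the right of
  -- `φ t ^ n`.
  let c : ℤ → G := fun n => (φ t) ^ (-n) * (φ t * z) ^ n
  have hc (n : ℤ) : c n ∈ Z := by
    have hnat (n : ℕ) : (φ t * z) ^ n * (φ t ^ n)⁻¹ ∈ Z := by
      induction n with
      | zero => simp [Z.one_mem]
      | succ n ih =>
        have : (φ t * z) ^ (n + 1) * (φ t ^ (n + 1))⁻¹ =
            (φ t * z * (φ t)⁻¹) * (φ t * ((φ t * z) ^ n * (φ t ^ n)⁻¹) * (φ t)⁻¹) := by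
          rw [pow_succ', pow_succ']; group
        rw [this]
        exact Z.mul_mem (hconj t z hzZ) (hconj t _ ih)
    have hint : (φ t * z) ^ n * (φ t ^ n)⁻¹ ∈ Z := by
      obtain ⟨m, rfl | rfl⟩ := n.eq_nat_or_neg
      · simpa using hnat m
      · have := hconj (t ^ (-(m : ℤ))) _ (Z.inv_mem (hnat m))
        simp only [zpow_neg, zpow_natCast] at this ⊢
        simpa [mul_assoc] using this
    have := hconj (t ^ (-n)) _ hint
    simp only [zpow_neg] at this
    simpa [c, mul_assoc] using this
  -- Since `x` is an element of `deg.ker` times `t ^ deg x`, its conjugation action on `Z` depends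
  -- on `deg x` only.
  have hcomm (x : F) (a : G) (ha : a ∈ Z) : (φ x)⁻¹ * a * φ x =
      (φ t) ^ (-(deg x).toAdd) * a * (φ t) ^ (deg x).toAdd := by
    have hk : x * t ^ (-(deg x).toAdd) ∈ deg.ker := by
      rw [MonoidHom.mem_ker, map_mul, map_zpow, ht, ← ofAdd_zsmul]
      simp
    have h1 := (hZ _).1 ha _ hk
    have hx : φ x = φ (x * t ^ (-(deg x).toAdd)) * (φ t) ^ (deg x).toAdd := by
      rw [← map_zpow, ← map_mul]; congr 1; group
    set y := φ (x * t ^ (-(deg x).toAdd))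
    set d := (deg x).toAdd
    rw [hx]
    calc (y * φ t ^ d)⁻¹ * a * (y * φ t ^ d) = (φ t ^ d)⁻¹ * y⁻¹ * (a * y) * φ t ^ d := by group
      _ = _ := by rw [← h1]; group
  refine ⟨MonoidHom.mk' (fun x => φ x * c (deg x).toAdd) fun a b => ?_, fun k hk => ?_, ?_⟩
  · have h1 := hcomm b (c (deg a).toAdd) (hc _)
    have h2 : c (deg a).toAdd * φ b = φ b * ((φ b)⁻¹ * c (deg a).toAdd * φ b) := by group
    calc φ (a * b) * c (deg (a * b)).toAdd = φ a * φ b * c ((deg a).toAdd + (deg b).toAdd) := by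
          simp
      _ = φ a * (φ b * ((φ b)⁻¹ * c (deg a).toAdd * φ b)) * c (deg b).toAdd := by
          rw [h1]; simp only [c, zpow_add, neg_add_rev]; group
      _ = _ := by rw [← h2]; group
  · simp [MonoidHom.mem_ker.1 hk, c]
  · simp [ht, c]

/-- **Solomon's theorem** for homomorphisms: if `w` lies in the kernel of an epimorphism `F → ℤ`,
then the number of homomorphisms `F → G` that map `w` to `g` is divisible by the order of the
centralizer of `g`. -/
theorem card_stabilizer_dvd_card_monoidHom {F G : Type*} [Group F] [Group G]
    (deg : F →* Multiplicative ℤ) {t : F} (ht : deg t = Multiplicative.ofAdd 1) {w : F}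
    (hw : deg w = 1) (g : G) :
    Nat.card (MulAction.stabilizer (ConjAct G) g) ∣ Nat.card {φ : F →* G // φ w = g} := by
  let H := MulAction.stabilizer (ConjAct G) g
  -- `X` consists of the restrictions to `deg.ker` of the homomorphisms to be counted. The
  -- extensions of `ρ ∈ X` correspond to the `z` centralizing its image; such `z` lie in `H` because
  -- `w ∈ deg.ker`. So the homomorphisms biject with pairs `(h, ρ)` where `h` fixes `ρ`, and
  -- Burnside's lemma counts these as `|H|` times the number of orbits.
  let X : SubMulAction H (deg.ker → G) :=
    { carrier := {ρ | ∃ φ : F →* G, φ w = g ∧ ∀ k, ρ k = φ k}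
      smul_mem' := by
        rintro h ρ ⟨φ, hφ, hρ⟩
        refine ⟨(MulAut.conj (ConjAct.ofConjAct (h : ConjAct G))).toMonoidHom.comp φ, ?_,
          fun k => ?_⟩
        · have := h.2
          rw [MulAction.mem_stabilizer_iff, ConjAct.smul_def] at this
          simpa [hφ] using this
        · rw [Pi.smul_apply, hρ]
          exact ConjAct.smul_def _ _ }
  have hfix (h : H) (ρ : X) (hρ : ρ ∈ MulAction.fixedBy X h) (k : deg.ker) :
      ρ.1 k * ConjAct.ofConjAct (h : ConjAct G) = ConjAct.ofConjAct (h : ConjAct G) * ρ.1 k := by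
    have h1 : (h : ConjAct G) • ρ.1 k = ρ.1 k := congrFun (congrArg Subtype.val hρ) k
    rw [ConjAct.smul_def, mul_inv_eq_iff_eq_mul] at h1
    exact h1.symm
  choose Φ hΦw hΦ using fun ρ : X => ρ.2
  have key (p : Σ h : H, MulAction.fixedBy X h) : ∃ ψ : F →* G,
      (∀ k : deg.ker, ψ k = p.2.1.1 k) ∧ ψ t = Φ p.2.1 t * ConjAct.ofConjAct (p.1 : ConjAct G) := by
    obtain ⟨h, ρ, hρ⟩ := p
    obtain ⟨ψ, h1, h2⟩ := MonoidHom.exists_twist deg ht (Φ ρ)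
      (z := ConjAct.ofConjAct (h : ConjAct G)) fun k hk => by
        rw [← hΦ ρ ⟨k, hk⟩]; exact hfix h ρ hρ ⟨k, hk⟩
    exact ⟨ψ, fun k => (h1 k k.2).trans (hΦ ρ k).symm, h2⟩
  choose Ψ hΨ hΨt using key
  let e : (Σ h : H, MulAction.fixedBy X h) → {φ : F →* G // φ w = g} := fun p =>
    ⟨Ψ p, by rw [hΨ p ⟨w, hw⟩, hΦ, hΦw]⟩
  have he : Function.Bijective e := by
    constructor
    · intro p q hpq
      have hpq : Ψ p = Ψ q := congrArg Subtype.val hpq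
      have hρ : p.2.1 = q.2.1 := by
        ext k
        rw [← hΨ, ← hΨ, hpq]
      have hh : p.1 = q.1 := by
        have h1 := hΨt p
        rw [hpq, hΨt q, hρ, mul_right_inj] at h1
        exact Subtype.ext (ConjAct.ofConjAct.injective h1.symm)
      obtain ⟨h, ρ, _⟩ := p
      obtain ⟨h', ρ', _⟩ := q
      obtain rfl : h = h' := hh
      obtain rfl : ρ = ρ' := hρ
      rfl
    · rintro ⟨ψ, hψ⟩
      let ρ : X := ⟨fun k => ψ k, ψ, hψ, fun _ => rfl⟩
      have hρ (k : F) (hk : k ∈ deg.ker) : Φ ρ k = ψ k := (hΦ ρ ⟨k, hk⟩).symm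
      -- Both extensions of `ρ` induce the same conjugation by the image of `t` on the image of
      -- `deg.ker`, so `z` centralizes it.
      let z := (Φ ρ t)⁻¹ * ψ t
      have hz (k : F) (hk : k ∈ deg.ker) : ψ k * z = z * ψ k := by
        have h1 := hρ (t * k * t⁻¹) ((inferInstance : deg.ker.Normal).conj_mem k hk t)
        simp only [map_mul, map_inv, hρ k hk] at h1
        have h2 : ψ k = (Φ ρ t)⁻¹ * (Φ ρ t * ψ k * (Φ ρ t)⁻¹) * Φ ρ t := by group
        rw [h1] at h2
        calc ψ k * z = (Φ ρ t)⁻¹ * (ψ t * ψ k * (ψ t)⁻¹) * Φ ρ t * ((Φ ρ t)⁻¹ * ψ t) := by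
              rw [← h2]
          _ = z * ψ k := by simp only [z]; group
      have hzH : ConjAct.toConjAct z ∈ H := by
        have h3 := hz w hw
        rw [hψ] at h3
        rw [MulAction.mem_stabilizer_iff, ConjAct.toConjAct_smul, ← h3]
        group
      have hfx : ρ ∈ MulAction.fixedBy X (⟨ConjAct.toConjAct z, hzH⟩ : H) := by
        refine Subtype.ext (funext fun k => ?_)
        change ConjAct.toConjAct z • ψ k = ψ k
        rw [ConjAct.toConjAct_smul, ← hz k k.2]
        group
      refine ⟨⟨⟨ConjAct.toConjAct z, hzH⟩, ρ, hfx⟩, Subtype.ext ?_⟩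
      change Ψ _ = ψ
      set p : Σ h : H, MulAction.fixedBy X h := ⟨⟨ConjAct.toConjAct z, hzH⟩, ρ, hfx⟩
      have hpt : Ψ p t = ψ t := by
        rw [hΨt p]; simp [p, z]
      ext x
      have hk : x * t ^ (-(deg x).toAdd) ∈ deg.ker := by
        rw [MonoidHom.mem_ker, map_mul, map_zpow, ht, ← ofAdd_zsmul]
        simp
      have hx : x = x * t ^ (-(deg x).toAdd) * t ^ (deg x).toAdd := by group
      rw [hx, map_mul _ (x * _), map_mul _ (x * _), map_zpow, map_zpow, hpt, hΨ p ⟨_, hk⟩]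
  rw [← Nat.card_congr (Equiv.ofBijective e he),
    Nat.card_congr (MulAction.sigmaFixedByEquivOrbitsProdGroup H X), Nat.card_prod]
  exact dvd_mul_left _ _

/-- When `a`, `b` are the exponent sums of two letters in a word, this gives an epimorphism onto `ℤ`
killing the word: `(p, q)` is `(b, -a)` divided by the gcd. -/
theorem Int.exists_bezout_eq_one_and_mul_add_mul_eq_zero (a b : ℤ) :
    ∃ p q u v : ℤ, u * p + v * q = 1 ∧ p * a + q * b = 0 := by
  by_cases h : Int.gcd a b = 0
  · rw [Int.gcd_eq_zero_iff] at h
    exact ⟨1, 0, 1, 0, by simp [h.1, h.2]⟩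
  · obtain ⟨a', ha⟩ := Int.gcd_dvd_left a b
    obtain ⟨b', hb⟩ := Int.gcd_dvd_right a b
    have hb' := Int.gcd_eq_gcd_ab a b
    refine ⟨b', -a', Int.gcdB a b, -Int.gcdA a b, ?_, ?_⟩
    · have hd : (Int.gcd a b : ℤ) ≠ 0 := by exact_mod_cast h
      apply mul_left_cancel₀ hd
      linear_combination (-Int.gcdB a b) * hb - Int.gcdA a b * ha - hb'
    · linear_combination b' * ha - a' * hb

/-- **Solomon's theorem**: for a word in at least two letters, the number of solutions of `w = g`
is divisible by the order of the centralizer of `g`. -/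
theorem card_stabilizer_dvd_card_solutions {G : Type*} [Group G] {r : ℕ} (hr : 2 ≤ r)
    (w : FreeGroup (Fin r)) (g : G) :
    Nat.card (MulAction.stabilizer (ConjAct G) g) ∣
      Nat.card {t : Fin r → G // FreeGroup.lift t w = g} := by
  let i : Fin r := ⟨0, by omega⟩
  let j : Fin r := ⟨1, by omega⟩
  have hij : j ≠ i := by simp [i, j]
  let ε (i : Fin r) : FreeGroup (Fin r) →* Multiplicative ℤ :=
    FreeGroup.lift (fun k => if k = i then Multiplicative.ofAdd 1 else 1)
  obtain ⟨p, q, u, v, h1, h2⟩ := Int.exists_bezout_eq_one_and_mul_add_mul_eq_zero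
    (ε i w).toAdd (ε j w).toAdd
  let deg : FreeGroup (Fin r) →* Multiplicative ℤ :=
    (zpowGroupHom p).comp (ε i) * (zpowGroupHom q).comp (ε j)
  have ht : deg (FreeGroup.of i ^ u * FreeGroup.of j ^ v) = Multiplicative.ofAdd 1 := by
    apply Multiplicative.toAdd.injective
    simp [deg, ε, hij, hij.symm]
    linarith
  have hw : deg w = 1 := by
    apply Multiplicative.toAdd.injective
    simpa [deg] using h2
  have := card_stabilizer_dvd_card_monoidHom deg ht hw g
  rwa [← Nat.card_congr ((FreeGroup.lift (β := G)).subtypeEquiv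
    (p := fun t : Fin r → G => FreeGroup.lift t w = g) fun t => Iff.rfl)] at this

/-! ### Galois action on character values. -/

open Polynomial in
/-- The traces of the powers of an endomorphism of order dividing `N` are the values of one integer
polynomial at the powers of a primitive `N`-th root of unity. -/
theorem LinearMap.exists_trace_pow_eq_aeval {V : Type*} [AddCommGroup V] [Module ℂ V]
    [FiniteDimensional ℂ V] {f : Module.End ℂ V} {N : ℕ} [NeZero N] (hf : f ^ N = 1) {ζ : ℂ}
    (hζ : IsPrimitiveRoot ζ N) :
    ∃ P : ℤ[X], ∀ k : ℕ, LinearMap.trace ℂ V (f ^ k) = aeval (ζ ^ k) P := by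
  -- As `X ^ N - 1` is squarefree, `V` is the direct sum of the eigenspaces for the powers of `ζ`.
  -- Their dimensions are the coefficients of the polynomial.
  have hss : f.IsSemisimple := by
    refine Module.End.isSemisimple_of_squarefree_aeval_eq_zero (p := (X ^ N - 1 : ℂ[X])) ?_ ?_
    · exact ((X_pow_sub_one_separable_iff (F := ℂ)).2 (by simp [NeZero.ne N])).squarefree
    · simp [hf]
  let E : Fin N → Submodule ℂ V := fun i => f.eigenspace (ζ ^ (i : ℕ))
  have hinj : Function.Injective fun i : Fin N => ζ ^ (i : ℕ) := fun i j h =>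
    Fin.ext (hζ.pow_inj i.2 j.2 h)
  have hind : iSupIndep E := (Module.End.eigenspaces_iSupIndep f).comp hinj
  have htop : iSup E = ⊤ := by
    rw [eq_top_iff, ← hss.iSup_eigenspace_eq_top]
    refine iSup_le fun μ => ?_
    by_cases hμ : f.eigenspace μ = ⊥
    · rw [hμ]; exact bot_le
    · obtain ⟨x, hx, hx0⟩ := Submodule.exists_mem_ne_zero_of_ne_bot hμ
      have h1 : (f ^ N) x = μ ^ N • x := Module.End.HasEigenvector.pow_apply ⟨hx, hx0⟩ N
      rw [hf, Module.End.one_apply] at h1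
      have h2 : μ ^ N = 1 := by
        have : (μ ^ N - 1) • x = 0 := by rw [sub_smul, ← h1, one_smul, sub_self]
        exact sub_eq_zero.1 ((smul_eq_zero.1 this).resolve_right hx0)
      obtain ⟨i, hi, rfl⟩ := hζ.eq_pow_of_pow_eq_one h2
      exact le_iSup E ⟨i, hi⟩
  have hint : DirectSum.IsInternal E :=
    (DirectSum.isInternal_submodule_iff_iSupIndep_and_iSup_eq_top E).2 ⟨hind, htop⟩
  have happ (k : ℕ) (i : Fin N) (x : V) (hx : x ∈ E i) : (f ^ k) x = (ζ ^ (i : ℕ)) ^ k • x := by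
    induction k with
    | zero => simp
    | succ k ih =>
      rw [pow_succ', Module.End.mul_apply, ih, map_smul, Module.End.mem_eigenspace_iff.1 hx,
        smul_smul, pow_succ]
  refine ⟨∑ i : Fin N, (Module.finrank ℂ (E i) : ℤ[X]) * X ^ (i : ℕ), fun k => ?_⟩
  have hmaps (i : Fin N) : Set.MapsTo (f ^ k) (E i) (E i) := fun x hx => by
    rw [happ k i x hx]; exact (E i).smul_mem _ hx
  rw [LinearMap.trace_eq_sum_trace_restrict hint hmaps, map_sum]
  refine Finset.sum_congr rfl fun i _ => ?_
  have : (f ^ k).restrict (hmaps i) = (ζ ^ (i : ℕ)) ^ k • LinearMap.id :=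
    LinearMap.ext fun x => Subtype.ext (happ k i x x.2)
  rw [this]
  simp [mul_comm, ← pow_mul]

-- `ζ ^ k` has the same minimal polynomial over `ℤ` as `ζ`, and it divides `P - c`.
open Polynomial in
theorem IsPrimitiveRoot.aeval_pow_eq_intCast {ζ : ℂ} {N : ℕ} [NeZero N] (hζ : IsPrimitiveRoot ζ N)
    {P : ℤ[X]} {c : ℤ} (h : aeval ζ P = c) {k : ℕ} (hk : k.Coprime N) : aeval (ζ ^ k) P = c := by
  have hi : IsIntegral ℤ ζ := hζ.isIntegral (NeZero.pos N)
  have hdvd : minpoly ℤ ζ ∣ P - C c :=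
    minpoly.isIntegrallyClosed_dvd hi (by simp [h])
  rw [hζ.minpoly_eq_pow_coprime hk] at hdvd
  obtain ⟨Q, hQ⟩ := hdvd
  have := congrArg (aeval (ζ ^ k)) hQ
  rw [map_mul, minpoly.aeval, zero_mul] at this
  simpa [sub_eq_zero] using this

open Polynomial in
theorem IsComplexCharacter.exists_apply_pow_eq_aeval {G : Type*} [Group G] {χ : G → ℂ}
    (hχ : IsComplexCharacter χ) {g : G} {N : ℕ} [NeZero N] (hg : g ^ N = 1) {ζ : ℂ}
    (hζ : IsPrimitiveRoot ζ N) : ∃ P : ℤ[X], ∀ k : ℕ, χ (g ^ k) = aeval (ζ ^ k) P := by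
  obtain ⟨n, ρ, rfl⟩ := hχ
  obtain ⟨P, hP⟩ := LinearMap.exists_trace_pow_eq_aeval (f := ρ g) (N := N)
    (by rw [← map_pow, hg, map_one]) hζ
  exact ⟨P, fun k => by rw [← hP, ← map_pow]; rfl⟩

theorem exists_coprime_pow_of_zpowers_eq {G : Type*} [Group G] [Finite G] {g h : G}
    (hgh : Subgroup.zpowers g = Subgroup.zpowers h) :
    ∃ k : ℕ, k.Coprime (orderOf g) ∧ h = g ^ k := by
  have hh : h ∈ Subgroup.zpowers g := hgh ▸ Subgroup.mem_zpowers h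
  obtain ⟨k, rfl⟩ := mem_powers_iff_mem_zpowers.2 hh
  refine ⟨k, ?_, rfl⟩
  have h1 : orderOf (g ^ k) = orderOf g := by
    rw [← Nat.card_zpowers, ← Nat.card_zpowers]
    exact congrArg (fun H : Subgroup G => Nat.card H) hgh.symm
  rw [orderOf_pow, Nat.div_eq_self] at h1
  exact Nat.coprime_comm.1 (h1.resolve_left (orderOf_pos g).ne')

/-- An integer-valued generalized character is constant on the generators of a cyclic subgroup. -/
theorem IsGeneralizedCharacter.apply_eq_of_zpowers_eq {G : Type*} [Group G] [Finite G] {f : G → ℂ}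
    (hf : IsGeneralizedCharacter f) {g h : G} (hgh : Subgroup.zpowers g = Subgroup.zpowers h)
    {c : ℤ} (hc : f g = c) : f h = f g := by
  obtain ⟨k, hk, rfl⟩ := exists_coprime_pow_of_zpowers_eq hgh
  obtain ⟨φ, ψ, hφ, hψ, rfl⟩ := hf
  have : NeZero (orderOf g) := ⟨(orderOf_pos g).ne'⟩
  have hζ := Complex.isPrimitiveRoot_exp (orderOf g) (NeZero.ne _)
  obtain ⟨P, hP⟩ := hφ.exists_apply_pow_eq_aeval (pow_orderOf_eq_one g) hζ
  obtain ⟨Q, hQ⟩ := hψ.exists_apply_pow_eq_aeval (pow_orderOf_eq_one g) hζ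
  have h1 (j : ℕ) : (φ - ψ) (g ^ j) =
      Polynomial.aeval (Complex.exp (2 * Real.pi * Complex.I / orderOf g) ^ j) (P - Q) := by
    rw [Pi.sub_apply, hP, hQ, map_sub]
  have h2 := h1 1
  rw [pow_one, pow_one, hc] at h2
  rw [h1, hζ.aeval_pow_eq_intCast h2.symm hk, hc]

open Polynomial in
/-- A Galois-invariant integer polynomial in a root of unity is rational. -/
theorem exists_ratCast_eq_aeval_of_forall_coprime {N : ℕ} [NeZero N] {ζ : ℂ}
    (hζ : IsPrimitiveRoot ζ N) (P : ℤ[X])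
    (h : ∀ k : ℕ, k.Coprime N → aeval (ζ ^ k) P = aeval ζ P) : ∃ q : ℚ, aeval ζ P = (q : ℂ) := by
  let K := CyclotomicField N ℚ
  let i : K →ₐ[ℚ] ℂ := IsAlgClosed.lift
  have : IsCyclotomicExtension {N} ℚ K := CyclotomicField.isCyclotomicExtension N ℚ
  have hz := IsCyclotomicExtension.zeta_spec N ℚ K
  set z := IsCyclotomicExtension.zeta N ℚ K
  have hiz : IsPrimitiveRoot (i z) N := hz.map_of_injective (f := i) i.injective
  -- The embedding need not send `z` to `ζ`, only to a conjugate `ζ ^ a`, which the invariance of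
  -- `P` absorbs.
  obtain ⟨a, _, ha, haz⟩ := hζ.isPrimitiveRoot_iff.1 hiz
  have hS (k : ℕ) (hk : k.Coprime N) : i (aeval (z ^ k) P) = aeval ζ P := by
    have : i (aeval (z ^ k) P) = aeval (i (z ^ k)) P :=
      (aeval_algHom_apply (i.restrictScalars ℤ) (z ^ k) P).symm
    rw [this, map_pow, ← haz, ← pow_mul, h _ (ha.mul_left hk)]
  have : IsGalois ℚ K := IsCyclotomicExtension.isGalois {N} ℚ K
  have : FiniteDimensional ℚ K := IsCyclotomicExtension.finiteDimensional {N} ℚ K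
  have hfix : aeval z P ∈ Set.range (algebraMap ℚ K) := by
    rw [IsGalois.mem_range_algebraMap_iff_fixed]
    intro σ
    obtain ⟨k, _, hk, hkz⟩ := hz.isPrimitiveRoot_iff.1
      (hz.map_of_injective (f := σ) σ.injective)
    apply (show Function.Injective i from i.injective)
    have h1 : σ (aeval z P) = aeval (σ z) P :=
      (aeval_algHom_apply (σ.toAlgHom.restrictScalars ℤ) z P).symm
    have h2 := hS 1 (Nat.coprime_one_left N)
    rw [pow_one] at h2
    rw [h1, ← hkz, hS k hk, h2]
  obtain ⟨q, hq⟩ := hfix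
  refine ⟨q, ?_⟩
  rw [← hS 1 (Nat.coprime_one_left N), pow_one, ← hq]
  simp

/-- If an integer-valued function is constant on the generators of cyclic subgroups, then its inner
products with characters are rational. -/
theorem IsComplexCharacter.exists_ratCast_eq_sum {G : Type*} [Group G] [Fintype G] {χ : G → ℂ}
    (hχ : IsComplexCharacter χ) (f : G → ℤ)
    (hf : ∀ g h : G, Subgroup.zpowers g = Subgroup.zpowers h → f g = f h) :
    ∃ q : ℚ, ∑ g, (f g : ℂ) * χ g⁻¹ = q := by
  let N := Nat.card G
  have hN : NeZero N := ⟨Nat.card_pos.ne'⟩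
  have hζ := Complex.isPrimitiveRoot_exp N (NeZero.ne _)
  set ζ := Complex.exp (2 * Real.pi * Complex.I / N)
  choose P hP using fun g : G =>
    hχ.exists_apply_pow_eq_aeval (g := g⁻¹) (pow_card_eq_one' (x := g⁻¹)) hζ
  have h1 (k : ℕ) : Polynomial.aeval (ζ ^ k) (∑ g, f g • P g) = ∑ g, (f g : ℂ) * χ (g⁻¹ ^ k) := by
    simp only [hP, map_sum, zsmul_eq_mul, map_mul, map_intCast]
  have h2 := h1 1
  simp only [pow_one] at h2
  rw [← h2]
  refine exists_ratCast_eq_aeval_of_forall_coprime hζ _ fun k hk => ?_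
  rw [h1, h2]
  have hk' : (Nat.card G).Coprime k := hk.symm
  -- As `k` is prime to `|G|`, `g ↦ g ^ k` permutes `G` and preserves `⟨g⟩`, hence `f`.
  refine Fintype.sum_equiv (powCoprime hk') _ _ fun g => ?_
  rw [powCoprime_apply, inv_pow]
  congr 2
  refine hf _ _ (le_antisymm ?_ ?_)
  · rw [Subgroup.zpowers_le]
    have : (powCoprime hk').symm (g ^ k) = g := (powCoprime hk').symm_apply_apply g
    rw [powCoprime_symm_apply] at this
    exact Subgroup.mem_zpowers_iff.2 ⟨_, this⟩
  · rw [Subgroup.zpowers_le]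
    exact Subgroup.pow_mem _ (Subgroup.mem_zpowers g) k

/-- A semi-rational finite simple group satisfies the Amit–Vishne condition. -/
theorem IsSemiRational.amitVishneCondition {G : Type*} [Group G] [Finite G] [IsSimpleGroup G]
    (hG : IsSemiRational G) : AmitVishneCondition G :=
  amitVishneCondition_of_wordCount_eq fun r hr w g _ hgh =>
    ((hG r hr w).apply_eq_of_zpowers_eq hgh (g := g)
      (c := Nat.card {t : Fin r → G // FreeGroup.lift t w = g}) (by simp [wordCount])).symm

/-! ### Integrality of averaged Adams operations. -/

/-- A sum over walks. The endpoint weight `F` is arbitrary so that the induction can absorb the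
first edge into it; `F a b = M b a` later closes the walk. -/
theorem Matrix.sum_prod_castSucc_succ {ι R : Type*} [Fintype ι] [DecidableEq ι] [CommRing R]
    (M : Matrix ι ι R) (m : ℕ) (F : ι → ι → R) :
    ∑ v : Fin (m + 1) → ι, (∏ k : Fin m, M (v k.castSucc) (v k.succ)) * F (v 0) (v (Fin.last m)) =
      ∑ a, ∑ b, (M ^ m) a b * F a b := by
  induction m generalizing F with
  | zero =>
    rw [← (Equiv.funUnique (Fin 1) ι).symm.sum_comp]
    simp [Matrix.one_apply]
  | succ m ih =>
    rw [← (Fin.consEquiv fun _ : Fin (m + 2) => ι).sum_comp, Fintype.sum_prod_type]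
    refine Finset.sum_congr rfl fun a _ => ?_
    have h1 (u : Fin (m + 1) → ι) :
        (∏ k : Fin (m + 1), M (Fin.consEquiv (fun _ : Fin (m + 2) => ι) (a, u) k.castSucc)
          (Fin.consEquiv (fun _ : Fin (m + 2) => ι) (a, u) k.succ)) *
          F (Fin.consEquiv (fun _ : Fin (m + 2) => ι) (a, u) 0)
            (Fin.consEquiv (fun _ : Fin (m + 2) => ι) (a, u) (Fin.last (m + 1))) =
        (∏ k : Fin m, M (u k.castSucc) (u k.succ)) * (M a (u 0) * F a (u (Fin.last m))) := by
      rw [Fin.prod_univ_succ]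
      simp only [Fin.consEquiv_apply, Fin.castSucc_zero, Fin.cons_zero, Fin.cons_succ,
        ← Fin.succ_castSucc, ← Fin.succ_last]
      ring
    rw [Finset.sum_congr rfl fun u _ => h1 u, ih fun c b => M a c * F a b, Finset.sum_comm]
    refine Finset.sum_congr rfl fun b _ => ?_
    rw [pow_succ', Matrix.mul_apply, Finset.sum_mul]
    refine Finset.sum_congr rfl fun c _ => by ring

theorem Matrix.sum_prod_finRotate {ι R : Type*} [Fintype ι] [DecidableEq ι] [CommRing R]
    (M : Matrix ι ι R) (m : ℕ) :
    ∑ v : Fin (m + 1) → ι, ∏ k, M (v k) (v (finRotate (m + 1) k)) = (M ^ (m + 1)).trace := by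
  have h := M.sum_prod_castSucc_succ m fun a b => M b a
  simp only [pow_succ, Matrix.trace, Matrix.diag, Matrix.mul_apply]
  rw [← h]
  refine Finset.sum_congr rfl fun v _ => ?_
  rw [Fin.prod_univ_castSucc]
  simp

-- The eigenvalues are roots of the monic integer polynomial `X ^ N - X`, and the trace is their
-- sum.
open Polynomial in
theorem Matrix.isIntegral_trace_of_pow_eq_self {n : Type*} [Fintype n] [DecidableEq n]
    {A : Matrix n n ℂ} {N : ℕ} (hN : 1 < N) (hA : A ^ N = A) : IsIntegral ℤ A.trace := by
  rcases isEmpty_or_nonempty n with h | h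
  · simpa [Matrix.trace] using isIntegral_zero
  rw [Matrix.trace_eq_sum_roots_charpoly]
  refine IsIntegral.multiset_sum fun r hr => ?_
  have hr : r ∈ spectrum ℂ A :=
    Matrix.mem_spectrum_of_isRoot_charpoly ((mem_roots A.charpoly_monic.ne_zero).1 hr)
  have h1 := spectrum.subset_polynomial_aeval A (X ^ N - X : ℂ[X]) ⟨r, hr, rfl⟩
  simp only [map_sub, map_pow, aeval_X, hA, sub_self, spectrum.zero_eq, eval_sub, eval_pow, eval_X,
    Set.mem_singleton_iff] at h1
  refine ⟨X ^ N - X, monic_X_pow_sub (by rw [degree_X]; exact_mod_cast hN), ?_⟩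
  simpa using h1

/-- The `n`-th Kronecker power of a matrix. -/
def Matrix.kroneckerPow {ι R : Type*} [CommRing R] (n : ℕ) (M : Matrix ι ι R) :
    Matrix (Fin n → ι) (Fin n → ι) R :=
  Matrix.of fun v w => ∏ k, M (v k) (w k)

theorem Matrix.kroneckerPow_mul {ι R : Type*} [Fintype ι] [CommRing R] (n : ℕ)
    (A B : Matrix ι ι R) :
    (A * B).kroneckerPow n = A.kroneckerPow n * B.kroneckerPow n := by
  classical
  ext v w
  simp only [Matrix.kroneckerPow, Matrix.of_apply, Matrix.mul_apply, Finset.prod_univ_sum,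
    Fintype.piFinset_univ, Finset.prod_mul_distrib]

/-- The cyclic shift of the factors of a tensor power. -/
def finRotateArrow (n : ℕ) (ι : Type*) : Equiv.Perm (Fin n → ι) :=
  (finRotate n).symm.arrowCongr (Equiv.refl ι)

theorem finRotateArrow_apply {n : ℕ} {ι : Type*} (v : Fin n → ι) (k : Fin n) :
    finRotateArrow n ι v k = v (finRotate n k) := rfl

theorem Matrix.permMatrix_pow {n R : Type*} [Fintype n] [DecidableEq n] [CommRing R]
    (σ : Equiv.Perm n) (k : ℕ) : (σ ^ k).permMatrix R = σ.permMatrix R ^ k := by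
  induction k with
  | zero => simp
  | succ k ih => rw [pow_succ', Matrix.permMatrix_mul, ih, pow_succ]

/-- The average of the `n`-th Adams operation of a complex character is an algebraic integer. -/
theorem isIntegral_average_character_pow {G : Type*} [Group G] [Fintype G] {χ : G → ℂ}
    (hχ : IsComplexCharacter χ) (m : ℕ) :
    IsIntegral ℤ ((Nat.card G : ℂ)⁻¹ * ∑ g, χ (g ^ (m + 1))) := by
  classical
  obtain ⟨d, ρ, rfl⟩ := hχ
  let M : G →* Matrix (Fin d) (Fin d) ℂ :=
    (LinearMap.toMatrixAlgEquiv' (R := ℂ) (n := Fin d)).toMulEquiv.toMonoidHom.comp ρ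
  have hM (g : G) : (M g).trace = ρ.character g := by
    rw [Representation.character, LinearMap.trace_eq_matrix_trace ℂ (Pi.basisFun ℂ (Fin d))]
    rfl
  -- With `P` the cyclic shift of the tensor factors, `T g * P` has trace `χ (g ^ (m + 1))`. The
  -- averaging projection `E` commutes with `P`, so `E * P` equals its power of exponent `orderOf e
  -- + 1`, and its trace is the required average.
  let T (g : G) := (M g).kroneckerPow (m + 1)
  let e : Equiv.Perm (Fin (m + 1) → Fin d) := (finRotateArrow (m + 1) (Fin d)).symm
  let P : Matrix (Fin (m + 1) → Fin d) (Fin (m + 1) → Fin d) ℂ := e.permMatrix ℂ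
  let E := (Nat.card G : ℂ)⁻¹ • ∑ g, T g
  have hcard : (Nat.card G : ℂ) ≠ 0 := by exact_mod_cast Nat.card_pos.ne'
  have hTP (g : G) (v w) : (T g * P) v w = ∏ k, M g (v k) (w (finRotate (m + 1) k)) := by
    simp only [P, Equiv.Perm.permMatrix, PEquiv.mul_toMatrix_toPEquiv]
    rfl
  have hcomm (g : G) : Commute (T g) P := by
    ext v w
    rw [hTP]
    simp only [P, Equiv.Perm.permMatrix, PEquiv.toMatrix_toPEquiv_mul, T, Matrix.kroneckerPow,
      Matrix.submatrix_apply, Matrix.of_apply, id]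
    rw [← Equiv.prod_comp (finRotate (m + 1)) fun k => M g (e v k) (w k)]
    refine Finset.prod_congr rfl fun k _ => ?_
    rw [← finRotateArrow_apply (e v), (finRotateArrow (m + 1) (Fin d)).apply_symm_apply v]
  have hEP : Commute E P := (Commute.sum_left _ _ _ fun g _ => hcomm g).smul_left _
  have hEE : E * E = E := by
    have h1 (g : G) : T g * ∑ h, T h = ∑ h, T h := by
      rw [Finset.mul_sum]
      refine Fintype.sum_equiv (Equiv.mulLeft g) _ _ fun h => ?_
      simp only [T, Equiv.coe_mulLeft, map_mul, Matrix.kroneckerPow_mul]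
    have h2 : (∑ g, T g) * ∑ h, T h = (Nat.card G : ℂ) • ∑ h, T h := by
      rw [Finset.sum_mul, Finset.sum_congr rfl fun g _ => h1 g]
      simp [Nat.cast_smul_eq_nsmul]
    simp only [E]
    rw [smul_mul_smul_comm, h2, smul_smul, mul_assoc, inv_mul_cancel₀ hcard, mul_one]
  have hpow : (E * P) ^ (orderOf e + 1) = E * P := by
    rw [hEP.mul_pow, (show IsIdempotentElem E from hEE).pow_succ_eq, ← Matrix.permMatrix_pow,
      pow_succ, pow_orderOf_eq_one, one_mul]
  have := Matrix.isIntegral_trace_of_pow_eq_self (by have := orderOf_pos e; omega) hpow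
  convert this using 1
  simp only [E, smul_mul_assoc, Matrix.trace_smul, Finset.sum_mul, Matrix.trace_sum, smul_eq_mul]
  congr 1
  refine Finset.sum_congr rfl fun g _ => ?_
  rw [← hM, map_pow, ← Matrix.sum_prod_finRotate]
  exact Finset.sum_congr rfl fun v _ => (hTP g v v).symm

/-! ### Inner products of word counts with characters. -/

theorem IsComplexCharacter.apply_conj {G : Type*} [Group G] {χ : G → ℂ} (hχ : IsComplexCharacter χ)
    (g h : G) : χ (h * g * h⁻¹) = χ g := by
  obtain ⟨n, ρ, rfl⟩ := hχ
  exact ρ.char_conj g h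

/-- If the values of a class function are divisible by the orders of the centralizers, then its inner
products with characters are algebraic integers. -/
theorem IsComplexCharacter.isIntegral_sum_of_card_stabilizer_dvd {G : Type*} [Group G] [Fintype G]
    {χ : G → ℂ} (hχ : IsComplexCharacter χ) (f : G → ℤ) (hf : ∀ g h, f (h * g * h⁻¹) = f g)
    (hdvd : ∀ g : G, (Nat.card (MulAction.stabilizer (ConjAct G) g) : ℤ) ∣ f g) :
    IsIntegral ℤ ((Nat.card G : ℂ)⁻¹ * ∑ g, (f g : ℂ) * χ g⁻¹) := by
  classical
  have hχi : ∀ g, IsIntegral ℤ (χ g) := by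
    intro g
    have : NeZero (orderOf g) := ⟨(orderOf_pos g).ne'⟩
    have hζ := Complex.isPrimitiveRoot_exp (orderOf g) (NeZero.ne _)
    obtain ⟨P, hP⟩ := hχ.exists_apply_pow_eq_aeval (pow_orderOf_eq_one g) hζ
    have h1 := hP 1
    rw [pow_one, pow_one] at h1
    rw [h1]
    exact adjoin_le_integralClosure (hζ.isIntegral (NeZero.pos _))
      (Polynomial.aeval_mem_adjoin_singleton ℤ _)
  have hcard : (Nat.card G : ℂ) ≠ 0 := by exact_mod_cast Nat.card_pos.ne'
  -- The class of `x` has `|G| / |C(x)|` elements, so it contributes `f x / |C(x)|` times `χ x⁻¹`.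
  rw [← Finset.sum_fiberwise Finset.univ ConjClasses.mk, Finset.mul_sum]
  refine IsIntegral.sum _ fun c _ => ?_
  obtain ⟨x, rfl⟩ := ConjClasses.exists_rep c
  obtain ⟨n, hn⟩ := hdvd x
  have h1 : ∀ g ∈ Finset.univ.filter (fun g => ConjClasses.mk g = ConjClasses.mk x),
      (f g : ℂ) * χ g⁻¹ = (f x : ℂ) * χ x⁻¹ := by
    intro g hg
    obtain ⟨c, rfl⟩ := isConj_iff.1 (ConjClasses.mk_eq_mk_iff_isConj.1 (Finset.mem_filter.1 hg).2.symm)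
    rw [hf, show (c * x * c⁻¹)⁻¹ = c * x⁻¹ * c⁻¹ by group, hχ.apply_conj]
  rw [Finset.sum_congr rfl h1, Finset.sum_const, nsmul_eq_mul]
  have h2 : (Finset.univ.filter (fun g => ConjClasses.mk g = ConjClasses.mk x)).card =
      (MulAction.stabilizer (ConjAct G) x).index := by
    rw [MulAction.index_stabilizer, ← Set.ncard_coe_finset]
    congr 1
    ext g
    simp [ConjAct.mem_orbit_conjAct, ConjClasses.mk_eq_mk_iff_isConj]
  have h3 : (Nat.card G : ℂ) = Nat.card (MulAction.stabilizer (ConjAct G) x) *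
      (MulAction.stabilizer (ConjAct G) x).index := by
    have := (MulAction.stabilizer (ConjAct G) x).card_mul_index
    rw [← Nat.cast_mul, this]
    rfl
  have h4 : (Nat.card G : ℂ)⁻¹ * ((Finset.univ.filter
      (fun g => ConjClasses.mk g = ConjClasses.mk x)).card * ((f x : ℂ) * χ x⁻¹)) = n * χ x⁻¹ := by
    rw [inv_mul_eq_iff_eq_mul₀ hcard, h2, h3, hn]
    push_cast
    ring
  rw [h4]
  exact (isIntegral_algebraMap (R := ℤ) (x := n)).mul (hχi _)

theorem FreeGroup.exists_eq_of_default_zpow {ι : Type*} [Unique ι] (w : FreeGroup ι) :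
    ∃ n : ℤ, w = FreeGroup.of default ^ n := by
  induction w using FreeGroup.induction_on with
  | C1 => exact ⟨0, by simp⟩
  | of x => exact ⟨1, by simp [Subsingleton.elim x default]⟩
  | inv_of x _ => exact ⟨-1, by simp [Subsingleton.elim x default]⟩
  | mul x y hx hy =>
    obtain ⟨a, rfl⟩ := hx
    obtain ⟨b, rfl⟩ := hy
    exact ⟨a + b, by rw [zpow_add]⟩

theorem exists_zpow_eq_pow_succ (G : Type*) [Group G] [Finite G] (n : ℤ) :
    ∃ m : ℕ, ∀ x : G, x ^ n = x ^ (m + 1) := by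
  have hpos : 0 < Nat.card G := Nat.card_pos
  -- Adding `|G|` to the residue keeps the exponent `m + 1` positive even when the residue is `0`.
  refine ⟨(n % Nat.card G).toNat + (Nat.card G - 1), fun x => ?_⟩
  rw [add_assoc, Nat.sub_add_cancel hpos, pow_add, pow_card_eq_one', mul_one, ← zpow_natCast,
    Int.toNat_of_nonneg (Int.emod_nonneg _ (by omega)), zpow_mod_natCard]

theorem sum_wordCount_mul {G : Type*} [Group G] [Fintype G] {r : ℕ} (w : FreeGroup (Fin r))
    (F : G → ℂ) : ∑ g, wordCount G w g * F g = ∑ t : Fin r → G, F (FreeGroup.lift t w) := by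
  classical
  rw [← Finset.sum_fiberwise Finset.univ fun t : Fin r → G => FreeGroup.lift t w]
  refine Finset.sum_congr rfl fun g _ => ?_
  rw [Finset.sum_congr rfl fun t ht => by rw [(Finset.mem_filter.1 ht).2], Finset.sum_const,
    nsmul_eq_mul, wordCount, Nat.card_eq_fintype_card, Fintype.card_subtype]

/-- The inner products of word counts with characters are algebraic integers. -/
theorem IsComplexCharacter.isIntegral_sum_wordCount {G : Type*} [Group G] [Fintype G] {χ : G → ℂ}
    (hχ : IsComplexCharacter χ) {r : ℕ} (hr : 1 ≤ r) (w : FreeGroup (Fin r)) :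
    IsIntegral ℤ ((Nat.card G : ℂ)⁻¹ * ∑ g, wordCount G w g * χ g⁻¹) := by
  rcases hr.eq_or_lt with rfl | hr
  · obtain ⟨n, hn⟩ := FreeGroup.exists_eq_of_default_zpow w
    -- The sign comes from evaluating `χ` at inverses.
    obtain ⟨m, hm⟩ := exists_zpow_eq_pow_succ G (-n)
    rw [sum_wordCount_mul w fun g => χ g⁻¹]
    convert isIntegral_average_character_pow hχ m using 2
    refine Fintype.sum_equiv (Equiv.funUnique (Fin 1) G) _ _ fun t => ?_
    rw [hn, map_zpow, FreeGroup.lift_apply_of, ← zpow_neg, hm]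
    rfl
  · refine hχ.isIntegral_sum_of_card_stabilizer_dvd
      (fun g => Nat.card {t : Fin r → G // FreeGroup.lift t w = g}) (fun g h => ?_) (fun g => ?_)
    · have := wordCount_conj w g h
      unfold wordCount at this
      exact_mod_cast this
    · exact_mod_cast card_stabilizer_dvd_card_solutions hr w g

/-- Under the Amit–Vishne condition, the inner products of word counts with characters are
integers. -/
theorem AmitVishneCondition.exists_intCast_eq_sum_wordCount {G : Type*} [Group G] [Fintype G]
    (hG : AmitVishneCondition G) {χ : G → ℂ}
    (hχ : IsComplexCharacter χ) {r : ℕ} (hr : 1 ≤ r) (w : FreeGroup (Fin r)) :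
    ∃ a : ℤ, (Nat.card G : ℂ)⁻¹ * ∑ g, wordCount G w g * χ g⁻¹ = a := by
  have h1 := hχ.isIntegral_sum_wordCount hr w
  obtain ⟨q, hq⟩ := hχ.exists_ratCast_eq_sum
    (fun g => Nat.card {t : Fin r → G // FreeGroup.lift t w = g}) fun g h hgh => by
      obtain ⟨α, rfl⟩ := hG g h hgh
      have := wordCount_mulAut w α g
      unfold wordCount at this
      exact_mod_cast this.symm
  have h2 : (Nat.card G : ℂ)⁻¹ * ∑ g, wordCount G w g * χ g⁻¹ =
      algebraMap ℚ ℂ ((Nat.card G : ℚ)⁻¹ * q) := by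
    simp only [Int.cast_natCast] at hq
    simp only [wordCount]
    rw [hq]
    simp
  rw [h2] at h1 ⊢
  rw [isIntegral_algebraMap_iff (algebraMap ℚ ℂ).injective] at h1
  obtain ⟨a, ha⟩ := IsIntegrallyClosed.isIntegral_iff.1 h1
  exact ⟨a, by rw [← ha]; simp⟩

/-! ### Class functions and irreducible characters. -/

open scoped MonoidAlgebra

theorem Representation.isComplexCharacter {G V : Type*} [Group G] [AddCommGroup V] [Module ℂ V]
    [FiniteDimensional ℂ V] (ρ : Representation ℂ G V) : IsComplexCharacter ρ.character := by
  let e : V ≃ₗ[ℂ] (Fin (Module.finrank ℂ V) → ℂ) := (Module.finBasis ℂ V).equivFun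
  refine ⟨_, (MonoidHomClass.toMonoidHom e.conjRingEquiv).comp ρ, funext fun g => ?_⟩
  exact (LinearMap.trace_conj' (ρ g) e).symm

theorem IsComplexCharacter.add {G : Type*} [Group G] {φ ψ : G → ℂ} (hφ : IsComplexCharacter φ)
    (hψ : IsComplexCharacter ψ) : IsComplexCharacter (φ + ψ) := by
  obtain ⟨n, ρ, rfl⟩ := hφ
  obtain ⟨m, σ, rfl⟩ := hψ
  convert (ρ.prod σ).isComplexCharacter using 1
  ext g
  exact (LinearMap.trace_prodMap' (ρ g) (σ g)).symm

theorem isComplexCharacter_zero {G : Type*} [Group G] : IsComplexCharacter (0 : G → ℂ) :=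
  ⟨0, 1, funext fun g => by simp [Representation.character]⟩

/-- The additive group of generalized characters. -/
def generalizedCharacters (G : Type*) [Group G] : AddSubgroup (G → ℂ) where
  carrier := {f | IsGeneralizedCharacter f}
  zero_mem' := ⟨0, 0, isComplexCharacter_zero, isComplexCharacter_zero, by simp⟩
  add_mem' := by
    rintro _ _ ⟨a, b, ha, hb, rfl⟩ ⟨c, d, hc, hd, rfl⟩
    exact ⟨a + c, b + d, ha.add hc, hb.add hd, by abel⟩
  neg_mem' := by
    rintro _ ⟨a, b, ha, hb, rfl⟩
    exact ⟨b, a, hb, ha, by abel⟩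

theorem IsComplexCharacter.mem_generalizedCharacters {G : Type*} [Group G] {χ : G → ℂ}
    (hχ : IsComplexCharacter χ) : χ ∈ generalizedCharacters G :=
  ⟨χ, 0, hχ, isComplexCharacter_zero, by simp⟩

/-- A class function orthogonal to an irreducible character acts by zero on the representation. -/
theorem Representation.IsIrreducible.sum_smul_eq_zero {G V : Type*} [Group G] [Fintype G]
    [AddCommGroup V] [Module ℂ V] [FiniteDimensional ℂ V] (ρ : Representation ℂ G V)
    [ρ.IsIrreducible] {f : G → ℂ} (hf : ∀ g h, f (h * g * h⁻¹) = f g)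
    (h0 : ∑ g, f g * ρ.character g⁻¹ = 0) : ∑ g, f g • ρ g⁻¹ = 0 := by
  -- The operator is an intertwiner because `f` is a class function, so it is a scalar by Schur's
  -- lemma; its trace vanishes by `h0`, hence so does the scalar.
  let T : ρ.IntertwiningMap ρ := ⟨∑ g, f g • ρ g⁻¹, fun h => by
    change (∑ g, f g • ρ g⁻¹) * ρ h = ρ h * ∑ g, f g • ρ g⁻¹
    rw [Finset.sum_mul, Finset.mul_sum]
    refine Fintype.sum_equiv (MulAut.conj h⁻¹).toEquiv _ _ fun g => ?_
    change f g • ρ g⁻¹ * ρ h = ρ h * f (h⁻¹ * g * h⁻¹⁻¹) • ρ (h⁻¹ * g * h⁻¹⁻¹)⁻¹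
    rw [hf, smul_mul_assoc, mul_smul_comm, ← map_mul, ← map_mul]
    congr 2
    group⟩
  obtain ⟨c, hc⟩ :=
    (Representation.IsIrreducible.algebraMap_intertwiningMap_bijective_of_isAlgClosed
      (ρ := ρ)).2 T
  have hT : ∑ g, f g • ρ g⁻¹ = c • (1 : Module.End ℂ V) :=
    (congrArg Representation.IntertwiningMap.toLinearMap hc).symm
  have htr := congrArg (LinearMap.trace ℂ V) hT
  simp only [map_sum, map_smul, LinearMap.trace_one, smul_eq_mul] at htr
  have : Nontrivial V := by
    have := IsSimpleModule.nontrivial ℂ[G] ρ.asModule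
    exact this
  have hd : (Module.finrank ℂ V : ℂ) ≠ 0 := by exact_mod_cast Module.finrank_pos.ne'
  rw [show ∑ g, f g * LinearMap.trace ℂ V (ρ g⁻¹) = 0 from h0] at htr
  rw [hT, (mul_eq_zero.1 htr.symm).resolve_right hd, zero_smul]

/-- The characters of the simple submodules of the group algebra. -/
def irreducibleCharacters (G : Type*) [Group G] : Set (G → ℂ) :=
  {χ | ∃ S : Submodule ℂ[G] ℂ[G], IsSimpleModule ℂ[G] S ∧
    χ = (Representation.ofModule' (k := ℂ) (G := G) S).character}

instance finiteDimensional_submodule_monoidAlgebra {G : Type*} [Group G] [Finite G]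
    (S : Submodule ℂ[G] ℂ[G]) : FiniteDimensional ℂ S :=
  inferInstanceAs (FiniteDimensional ℂ (S.restrictScalars ℂ))

theorem Representation.asAlgebraHom_ofModule' {k G M : Type*} [CommSemiring k] [Monoid G]
    [AddCommMonoid M] [Module k M] [Module k[G] M] [IsScalarTower k k[G] M] :
    (Representation.ofModule' (k := k) (G := G) M).asAlgebraHom = Algebra.lsmul k k M :=
  (MonoidAlgebra.lift k (M →ₗ[k] M) G).apply_symm_apply _

theorem Representation.isIrreducible_ofModule' {k G M : Type*} [Field k] [Monoid G]
    [AddCommGroup M] [Module k M] [Module k[G] M] [IsScalarTower k k[G] M]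
    [IsSimpleModule k[G] M] : (Representation.ofModule' (k := k) (G := G) M).IsIrreducible := by
  rw [Representation.irreducible_iff_isSimpleModule_asModule]
  let ρ := Representation.ofModule' (k := k) (G := G) M
  let e : ρ.asModule ≃ₗ[k[G]] M :=
    { ρ.asModuleEquiv.toAddEquiv with
      map_smul' := fun r x => by
        change ρ.asModuleEquiv (r • x) = r • ρ.asModuleEquiv x
        rw [Representation.asModuleEquiv_map_smul, Representation.asAlgebraHom_ofModule']
        rfl }
  exact IsSimpleModule.congr e

/-- The average of `f(g) χ(g⁻¹)`, as a linear form in `f`. -/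
noncomputable def averageMul {G : Type*} [Group G] [Fintype G] (χ : G → ℂ) : (G → ℂ) →ₗ[ℂ] ℂ where
  toFun f := (Nat.card G : ℂ)⁻¹ * ∑ g, f g * χ g⁻¹
  map_add' f f' := by simp only [Pi.add_apply, add_mul, Finset.sum_add_distrib, mul_add]
  map_smul' c f := by
    simp only [Pi.smul_apply, smul_eq_mul, RingHom.id_apply, mul_assoc, ← Finset.mul_sum]
    ring

theorem averageMul_apply {G : Type*} [Group G] [Fintype G] (χ f : G → ℂ) :
    averageMul χ f = (Nat.card G : ℂ)⁻¹ * ∑ g, f g * χ g⁻¹ := rfl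

open scoped Classical in
theorem averageMul_of_mem_irreducibleCharacters {G : Type*} [Group G] [Fintype G] {φ ψ : G → ℂ}
    (hφ : φ ∈ irreducibleCharacters G) (hψ : ψ ∈ irreducibleCharacters G) :
    averageMul ψ φ = if φ = ψ then 1 else 0 := by
  obtain ⟨S, hS, rfl⟩ := hφ
  obtain ⟨R, hR, rfl⟩ := hψ
  have := Representation.isIrreducible_ofModule' (k := ℂ) (G := G) (M := S)
  have := Representation.isIrreducible_ofModule' (k := ℂ) (G := G) (M := R)
  have : Invertible (Nat.card G : ℂ) := invertibleOfNonzero (by exact_mod_cast Nat.card_pos.ne')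
  rw [averageMul_apply]
  split_ifs with h
  · rw [← h, Representation.char_orthonormal, if_pos ⟨Representation.Equiv.refl _⟩]
  · rw [Representation.char_orthonormal, if_neg fun ⟨e⟩ => h (Representation.char_iso e).symm]

theorem linearIndependent_irreducibleCharacters (G : Type*) [Group G] [Fintype G] :
    LinearIndependent ℂ (Subtype.val : irreducibleCharacters G → G → ℂ) := by
  classical
  rw [linearIndependent_iff']
  intro s c hc i hi
  have := congrArg (averageMul i.1) hc
  simpa [averageMul_of_mem_irreducibleCharacters, i.2, ← Subtype.ext_iff, hi] using this

/-- A class function orthogonal to all irreducible characters vanishes. -/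
theorem eq_zero_of_forall_averageMul_eq_zero {G : Type*} [Group G] [Fintype G] {f : G → ℂ}
    (hf : ∀ g h, f (h * g * h⁻¹) = f g)
    (h0 : ∀ χ ∈ irreducibleCharacters G, averageMul χ f = 0) : f = 0 := by
  have hcard : (Nat.card G : ℂ) ≠ 0 := by exact_mod_cast Nat.card_pos.ne'
  have : NeZero (Nat.card G : ℂ) := ⟨hcard⟩
  -- `z` annihilates every simple left ideal, and these span the semisimple algebra `ℂ[G]`; so `z =
  -- z * 1 = 0`, and its coefficients are the values of `f`.
  let z : ℂ[G] := ∑ g, f g • MonoidAlgebra.of ℂ G g⁻¹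
  have hz (x : ℂ[G]) : z * x = 0 := by
    have hx : x ∈ sSup {S : Submodule ℂ[G] ℂ[G] | IsSimpleModule ℂ[G] S} := by
      rw [IsSemisimpleModule.sSup_simples_eq_top]; trivial
    rw [sSup_eq_iSup'] at hx
    induction hx using Submodule.iSup_induction' with
    | zero => simp
    | add x y _ _ hx hy => rw [mul_add, hx, hy, add_zero]
    | mem S x hx =>
      obtain ⟨S, hS⟩ := S
      have hS : IsSimpleModule ℂ[G] S := hS
      have h1 := h0 _ ⟨S, hS, rfl⟩
      rw [averageMul_apply, mul_eq_zero] at h1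
      have := Representation.isIrreducible_ofModule' (k := ℂ) (G := G) (M := S)
      have h2 := Representation.IsIrreducible.sum_smul_eq_zero
        (Representation.ofModule' (k := ℂ) (G := G) S) hf (h1.resolve_left (inv_ne_zero hcard))
      have h3 : (Representation.ofModule' (k := ℂ) (G := G) S).asAlgebraHom z = 0 := by
        simp only [z, map_sum, map_smul, Representation.asAlgebraHom_of]
        exact h2
      rw [Representation.asAlgebraHom_ofModule'] at h3
      exact congrArg Subtype.val (LinearMap.congr_fun h3 ⟨x, hx⟩)
  have hz0 : z = 0 := by simpa using hz 1
  ext g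
  have := congrArg (fun y : ℂ[G] => y.coeff g⁻¹) hz0
  classical
  simpa [z, MonoidAlgebra.of_apply, Finsupp.single_apply] using this

/-- A class function whose inner products with characters are integers is a generalized
character. -/
theorem isGeneralizedCharacter_of_forall_averageMul {G : Type*} [Group G] [Fintype G] {f : G → ℂ}
    (hf : ∀ g h, f (h * g * h⁻¹) = f g)
    (hint : ∀ χ, IsComplexCharacter χ → ∃ a : ℤ, averageMul χ f = a) :
    IsGeneralizedCharacter f := by
  classical
  have : Finite (irreducibleCharacters G) := (linearIndependent_irreducibleCharacters G).finite
  have := Fintype.ofFinite (irreducibleCharacters G)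
  have hchar (χ : irreducibleCharacters G) : IsComplexCharacter χ.1 := by
    obtain ⟨_, S, _, rfl⟩ := χ
    exact Representation.isComplexCharacter _
  choose a ha using fun χ : irreducibleCharacters G => hint χ.1 (hchar χ)
  suffices f = ∑ χ : irreducibleCharacters G, a χ • χ.1 by
    have hmem : ∑ χ : irreducibleCharacters G, a χ • χ.1 ∈ generalizedCharacters G :=
      AddSubgroup.sum_mem _ fun χ _ =>
        AddSubgroup.zsmul_mem _ (hchar χ).mem_generalizedCharacters _
    rw [this]
    exact hmem
  rw [← sub_eq_zero]
  refine eq_zero_of_forall_averageMul_eq_zero (fun g h => ?_) fun ψ hψ => ?_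
  · simp [hf, (hchar _).apply_conj]
  · rw [map_sub, map_sum, ha ⟨ψ, hψ⟩, Finset.sum_eq_single ⟨ψ, hψ⟩]
    · rw [map_zsmul, averageMul_of_mem_irreducibleCharacters hψ hψ, if_pos rfl]
      simp
    · intro χ _ hne
      rw [map_zsmul, averageMul_of_mem_irreducibleCharacters χ.2 hψ,
        if_neg fun h => hne (Subtype.ext h), smul_zero]
    · simp

/-! ### The equivalence. -/

/-- A finite group with the Amit–Vishne condition is semi-rational. -/
theorem AmitVishneCondition.isSemiRational {G : Type*} [Group G] [Finite G]
    (hG : AmitVishneCondition G) : IsSemiRational G := by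
  have := Fintype.ofFinite G
  intro r hr w
  exact isGeneralizedCharacter_of_forall_averageMul (fun g h => wordCount_conj w g h)
    fun χ hχ => hG.exists_intCast_eq_sum_wordCount hχ hr w

theorem mainTheorem1 (G : Type*) [Group G] [Finite G] [IsSimpleGroup G] :
    IsSemiRational G ↔ AmitVishneCondition G :=
  ⟨fun h => h.amitVishneCondition, fun h => h.isSemiRational⟩
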